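/- For a finite word $w$ let $\mathrm{PL}(w)$ be its palindromic length, the minimal number of palindromes whose concatenation is $w$ (so $\mathrm{PL}(\varepsilon)=0$). Let $\mathbf{s}=s[1]s[2]s[3]\cdots$ be the Sierpinski word, the fixed point starting with $a$ of the morphism $a\to aba$, $b\to bbb$, let $p(n)=\mathrm{PL}(s[1]\cdots s[n])$ for $n\ge 0$ be its prefix palindromic length, and let $d_p(n)=p(n+1)-p(n)$, $n\ge 0$, be the sequence of first differences of $p$. Let $\mathcal{B}=\{A,B,C,D,\overline{A},\overline{B},\overline{C},\overline{D},S,S'\}$, let $\psi:\mathcal{B}^*\to\mathcal{B}^*$ be the $3$-uniform morphism \[ \begin{aligned} &\psi(A)=AB\overline{C}, &&\psi(B)=BSS, &&\psi(C)=AB\overline{D}, &&\psi(D)=DSS',\\ &\psi(\overline{A})=C\overline{B}\,\overline{A}, &&\psi(\overline{B})=SS\overline{B}, &&\psi(\overline{C})=D\overline{B}\,\overline{A}, &&\psi(\overline{D})=S'S\overline{D},\\ &\psi(S)=SSS, &&\psi(S')=DS\overline{D}, \end{aligned} \] and let $c:\mathcal{B}\to\{-1,0,+1\}$ be the coding with $c(A)=c(B)=c(C)=c(D)=+1$,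 $c(\overline{A})=c(\overline{B})=c(\overline{C})=c(\overline{D})=-1$, $c(S)=c(S')=0$. Let $\psi^\infty(A)$ be the infinite word that has all the words $\psi^m(A)$, $m\ge 0$, as prefixes. Then $d_p=c(\psi^\infty(A))$, that is, for every $n\ge 0$ the number $d_p(n)$ is the image under $c$ of the letter of $\psi^\infty(A)$ preceded by exactly $n$ letters. Consequently $d_p$ is $3$-automatic (some deterministic finite automaton with output, reading the base-$3$ representation of $n$, outputs $d_p(n)$ for every $n\ge 0$), and $p$ is $3$-regular (the $\mathbb{Z}$-module generated by the sequences $n\mapsto p(3^e n+j)$ with $e\ge 0$, $0\le j<3^e$ is finitely generated). -/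

import Mathlib

/-! ### Palindromic length

An infinite word over `α` is a function `u : ℕ → α`; `u i` is its letter number `i + 1`. -/

/-- The prefix of length `n` of an infinite word. -/
def wordPrefix {α : Type*} (u : ℕ → α) (n : ℕ) : List α :=
  (List.range n).map u

/-- `w` is the concatenation of `m` palindromes. -/
def IsPalindromicProduct {α : Type*} (w : List α) (m : ℕ) : Prop :=
  ∃ L : List (List α), L.length = m ∧ L.flatten = w ∧ ∀ P ∈ L, P.Palindrome

/-- The palindromic length of a finite word: the minimal number of palindromes whose
concatenation is the word. -/
noncomputable def palindromicLength {α : Type*} (w : List α) : ℕ :=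
  sInf {m : ℕ | IsPalindromicProduct w m}

/-- The minimum in the definition of the palindromic length is attained: every word is a
product of one-letter palindromes. -/
theorem palindromicLength_isLeast {α : Type*} (w : List α) :
    IsLeast {m : ℕ | IsPalindromicProduct w m} (palindromicLength w) := by
  have hne : {m : ℕ | IsPalindromicProduct w m}.Nonempty := by
    refine ⟨_, w.map (fun x => [x]), rfl, ?_, ?_⟩
    · induction w with
      | nil => rfl
      | cons x w ih => simp [ih]
    · intro P hP
      obtain ⟨x, -, rfl⟩ := List.mem_map.1 hP
      exact List.Palindrome.singleton x
  exact ⟨Nat.sInf_mem hne, fun m hm => Nat.sInf_le hm⟩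

/-- The prefix palindromic length of an infinite word. -/
noncomputable def prefixPalindromicLength {α : Type*} (u : ℕ → α) (n : ℕ) : ℕ :=
  palindromicLength (wordPrefix u n)

/-- The sequence of first differences of an integer sequence. -/
def firstDiff (r : ℕ → ℤ) (n : ℕ) : ℤ := r (n + 1) - r n

/-! ### Morphisms and their infinite words

A morphism of free monoids `α* → α*` is given by the images `f : α → List α` of the letters. -/

/-- The image of a finite word under a morphism. -/
def applyMorphism {α : Type*} (f : α → List α) (w : List α) : List α := w.flatMap f

/-- The morphism is `k`-uniform: the image of every letter has length `k`. -/
def IsUniformMorphism {α : Type*} (k : ℕ) (f : α → List α) : Prop := ∀ x, (f x).length = k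

/-- The infinite word `f^∞(a)`, the limit of the words `f^m(a)`, for a `k`-uniform morphism `f`
with `k ≥ 2` such that `f a` starts with `a`: its letter of index `n` is the letter of index `n`
of `f^n(a)`, a word of length `k ^ n > n` (so that the default value of `getD` is not used). -/
def morphicWord {α : Type*} (f : α → List α) (a : α) (n : ℕ) : α :=
  ((applyMorphism f)^[n] [a]).getD n a

theorem applyMorphism_length {α : Type*} {k : ℕ} {f : α → List α} (hf : IsUniformMorphism k f)
    (w : List α) : (applyMorphism f w).length = k * w.length := by
  induction w with
  | nil => simp [applyMorphism]
  | cons x w ih =>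
    simp only [applyMorphism, List.flatMap_cons, List.length_append, List.length_cons] at ih ⊢
    rw [ih, hf x]; ring

theorem applyMorphism_iterate_length {α : Type*} {k : ℕ} {f : α → List α}
    (hf : IsUniformMorphism k f) (a : α) (m : ℕ) :
    ((applyMorphism f)^[m] [a]).length = k ^ m := by
  induction m with
  | zero => simp
  | succ m ih => rw [Function.iterate_succ_apply', applyMorphism_length hf, ih]; ring

theorem applyMorphism_iterate_prefix {α : Type*} {f : α → List α} {a : α}
    (ha : [a] <+: f a) {m m' : ℕ} (h : m ≤ m') :
    (applyMorphism f)^[m] [a] <+: (applyMorphism f)^[m'] [a] := by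
  have step : ∀ j, (applyMorphism f)^[j] [a] <+: (applyMorphism f)^[j + 1] [a] := by
    intro j
    induction j with
    | zero => simpa [applyMorphism] using ha
    | succ j ih =>
      obtain ⟨t, ht⟩ := ih
      refine ⟨applyMorphism f t, ?_⟩
      rw [Function.iterate_succ_apply' _ (j + 1)]
      conv_rhs => rw [← ht]
      rw [Function.iterate_succ_apply' _ j]
      simp only [applyMorphism, List.flatMap_append]
  induction h with
  | refl => exact List.prefix_rfl
  | step _ ih => exact ih.trans (step _)

/-- `f^∞(a)` is the infinite word that has all the words `f^m(a)` as prefixes. -/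
theorem wordPrefix_morphicWord {α : Type*} {k : ℕ} {f : α → List α} (hk : 2 ≤ k)
    (hf : IsUniformMorphism k f) {a : α} (ha : [a] <+: f a) (m : ℕ) :
    wordPrefix (morphicWord f a) (k ^ m) = (applyMorphism f)^[m] [a] := by
  have hlen := applyMorphism_iterate_length hf a
  refine List.ext_getElem (by simp [wordPrefix, hlen]) fun i h₁ h₂ => ?_
  have hi : i < ((applyMorphism f)^[i] [a]).length := by
    rw [hlen]; exact Nat.lt_pow_self (by omega)
  simp only [wordPrefix, List.getElem_map, List.getElem_range, morphicWord]
  rw [List.getD_eq_getElem _ _ hi]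
  rcases le_total i m with h | h
  · exact (applyMorphism_iterate_prefix ha h).getElem hi
  · exact ((applyMorphism_iterate_prefix ha h).getElem h₂).symm

/-! ### Automatic and regular sequences -/

/-- The base-`k` representation of `n`, most significant digit first, without leading zeros;
`0` is represented by the empty word. -/
def baseRepresentation (k : ℕ) [NeZero k] (n : ℕ) : List (Fin k) :=
  ((Nat.digits k n).map (Fin.ofNat k)).reverse

/-- The sequence `u` is `k`-automatic (`k ≥ 2`): there is a deterministic finite automaton with
output that outputs `u n` when its input is the base-`k` representation of `n`. -/
def IsAutomaticSequence {β : Type*} (k : ℕ) [NeZero k] (u : ℕ → β) : Prop :=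
  ∃ (σ : Type) (_ : Finite σ) (step : σ → Fin k → σ) (start : σ) (output : σ → β),
    ∀ n, u n = output ((baseRepresentation k n).foldl step start)

/-- The `k`-kernel of a sequence: its subsequences `n ↦ r (k ^ e * n + j)` with `j < k ^ e`. -/
def kernelOfSequence (k : ℕ) (r : ℕ → ℤ) : Set (ℕ → ℤ) :=
  {g | ∃ e j : ℕ, j < k ^ e ∧ g = fun n => r (k ^ e * n + j)}

/-- An integer sequence is `k`-regular (`k ≥ 2`) if the `ℤ`-module generated by its `k`-kernel is
finitely generated. -/
def IsRegularSequence (k : ℕ) (r : ℕ → ℤ) : Prop :=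
  (Submodule.span ℤ (kernelOfSequence k r)).FG

/-! ### The Sierpinski word and the ten-letter morphism -/

/-- The alphabet of the Sierpinski word. -/
inductive SierpinskiLetter : Type
  | a | b

/-- The morphism `a ↦ aba`, `b ↦ bbb`. -/
def sierpinskiMorphism : SierpinskiLetter → List SierpinskiLetter
  | .a => [.a, .b, .a]
  | .b => [.b, .b, .b]

/-- The Sierpinski word. -/
def sierpinskiWord : ℕ → SierpinskiLetter := morphicWord sierpinskiMorphism .a

/-- The prefix palindromic length of the Sierpinski word, as an integer sequence. -/
noncomputable def sierpinskiPPL (n : ℕ) : ℤ := (prefixPalindromicLength sierpinskiWord n : ℤ)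

/-- The alphabet `{A, B, C, D, Ā, B̄, C̄, D̄, S, S'}`. -/
inductive DiffLetter : Type
  | A | B | C | D | Abar | Bbar | Cbar | Dbar | S | Sprime

open DiffLetter in
/-- The morphism `ψ`. -/
def psi : DiffLetter → List DiffLetter
  | A => [A, B, Cbar]
  | B => [B, S, S]
  | C => [A, B, Dbar]
  | D => [D, S, Sprime]
  | Abar => [C, Bbar, Abar]
  | Bbar => [S, S, Bbar]
  | Cbar => [D, Bbar, Abar]
  | Dbar => [Sprime, S, Dbar]
  | S => [S, S, S]
  | Sprime => [D, S, Dbar]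

open DiffLetter in
/-- The coding `c` to the alphabet `{-1, 0, 1}`. -/
def coding : DiffLetter → SignType
  | A | B | C | D => 1
  | Abar | Bbar | Cbar | Dbar => -1
  | S | Sprime => 0

/-! ### Letters of morphic words of uniform morphisms -/

/-! Let P(n) be the sum of the codes of the first n letters of ψ^∞(A) (`psiSum`); the claim is that
P equals the prefix palindromic length p. Remembering only which letters lie over b (`isB`) turns ψ
into the Sierpinski morphism, so ψ^∞(A) is the Sierpinski word with extra memory. The codes of ψ(y)
add up to the code of y, hence P(3n) = P(n).

Lower bound: P grows by at most 1 over a palindromic factor, and this is applied to the last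
palindrome of an optimal factorization. A palindromic factor of length at least two either is the
image of a palindromic factor ending earlier, with the same number r < 3 of letters cut off at both
ends, or is a power of b or bab (`IsPalindromicFactor.unaligned`). The finite table
`palindromicSums`, indexed by first and last letters, contains the sums of the exceptional factors
and is closed under these cuts; all its entries are at most 1.

Upper bound: a palindromic suffix over which P grows by exactly 1 is carried along ψ by the table
`suffixCandidates`. The exceptions are the letters S in a run opened by B, where the run itself
serves, the middle letters of ψ(D) and ψ(S'), where bab serves, and the letter B̄, where p(3n) ≤
p(n) and p(n) ≤ p(n+1) + 1 suffice.

Automaticity and regularity are then read off from ψ. -/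

theorem getElem?_applyMorphism {α : Type*} {k : ℕ} {f : α → List α} (hf : IsUniformMorphism k f)
    (w : List α) (n : ℕ) {r : ℕ} (hr : r < k) :
    (applyMorphism f w)[k * n + r]? = (w[n]?).bind fun x => (f x)[r]? := by
  induction w generalizing n with
  | nil => simp [applyMorphism]
  | cons x w ih =>
    simp only [applyMorphism, List.flatMap_cons] at ih ⊢
    cases n with
    | zero => simp [List.getElem?_append, hf x, hr]
    | succ n =>
      have h : ¬ k * (n + 1) + r < (f x).length := by rw [hf x, Nat.mul_succ]; omega
      have h' : k * (n + 1) + r - (f x).length = k * n + r := by rw [hf x, Nat.mul_succ]; omega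
      rw [List.getElem?_append, if_neg h, h', ih n, List.getElem?_cons_succ]

theorem getElem?_iterate_applyMorphism {α : Type*} {k : ℕ} {f : α → List α} (hk : 2 ≤ k)
    (hf : IsUniformMorphism k f) {a : α} (ha : [a] <+: f a) {m n : ℕ} (h : n < k ^ m) :
    ((applyMorphism f)^[m] [a])[n]? = some (morphicWord f a n) := by
  rw [← wordPrefix_morphicWord hk hf ha m]
  simp [wordPrefix, h]

/-- The fixed-point equation of the morphism, read letter by letter; every recursion modulo 3 below
rests on it. -/
theorem morphicWord_mul_add {α : Type*} {k : ℕ} {f : α → List α} (hk : 2 ≤ k)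
    (hf : IsUniformMorphism k f) {a : α} (ha : [a] <+: f a) (n : ℕ) {r : ℕ} (hr : r < k) :
    (f (morphicWord f a n))[r]? = some (morphicWord f a (k * n + r)) := by
  have hn : n < k ^ n := Nat.lt_pow_self (by omega)
  have hn' : k * n + r < k ^ (n + 1) := by
    have : k * (n + 1) ≤ k * k ^ n := Nat.mul_le_mul_left k hn
    rw [pow_succ']
    rw [Nat.mul_succ] at this
    omega
  rw [← getElem?_iterate_applyMorphism hk hf ha hn', Function.iterate_succ_apply',
    getElem?_applyMorphism hf _ _ hr, getElem?_iterate_applyMorphism hk hf ha hn]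
  rfl

/-! ### Palindromic length of prefixes -/

/-- The factor of `u` that occupies the positions `i` with `k ≤ i < n` is a palindrome. -/
def IsPalindromicFactor {α : Type*} (u : ℕ → α) (k n : ℕ) : Prop :=
  ∀ i j, i + j + 1 = k + n → k ≤ i → k ≤ j → u i = u j

theorem wordPrefix_add {α : Type*} (u : ℕ → α) (k l : ℕ) :
    wordPrefix u (k + l) = wordPrefix u k ++ (List.range l).map fun i => u (k + i) := by
  simp [wordPrefix, List.range_add]

theorem palindrome_map_range_iff {α : Type*} (u : ℕ → α) (k l : ℕ) :
    ((List.range l).map fun i => u (k + i)).Palindrome ↔ IsPalindromicFactor u k (k + l) := by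
  rw [List.Palindrome.iff_reverse_eq]
  constructor
  · intro h i j hij hi hj
    have h1 := congrArg (fun w => w[i - k]?) h
    have hlt : i - k < l := by omega
    have hlt' : l - 1 - (i - k) < l := by omega
    simp only [List.getElem?_reverse, List.length_map, List.length_range, hlt, List.getElem?_map,
      List.getElem?_range, hlt', Option.map_some, Option.some.injEq] at h1
    rw [show i = k + (i - k) by omega, show j = k + (l - 1 - (i - k)) by omega]
    exact h1.symm
  · intro h
    refine List.ext_getElem (by simp) fun i h₁ h₂ => ?_
    simp only [List.length_map, List.length_range] at h₂
    simp only [List.getElem_reverse, List.getElem_map, List.getElem_range, List.length_map,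
      List.length_range]
    exact h _ _ (by omega) (by omega) (by omega)

theorem prefixPalindromicLength_zero {α : Type*} (u : ℕ → α) : prefixPalindromicLength u 0 = 0 :=
  Nat.le_zero.1 ((palindromicLength_isLeast _).2 ⟨[], rfl, rfl, by simp⟩)

theorem IsPalindromicFactor.prefixPalindromicLength_le {α : Type*} {u : ℕ → α} {k n : ℕ}
    (h : IsPalindromicFactor u k n) (hkn : k ≤ n) :
    prefixPalindromicLength u n ≤ prefixPalindromicLength u k + 1 := by
  obtain ⟨l, rfl⟩ := Nat.exists_eq_add_of_le hkn
  obtain ⟨L, hL, hflat, hpal⟩ := (palindromicLength_isLeast (wordPrefix u k)).1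
  refine (palindromicLength_isLeast _).2
    ⟨L ++ [(List.range l).map fun i => u (k + i)], ?_, ?_, ?_⟩
  · simp [hL, prefixPalindromicLength]
  · simp [hflat, wordPrefix_add]
  · intro P hP
    rcases List.mem_append.1 hP with hP | hP
    · exact hpal P hP
    · rw [List.mem_singleton.1 hP]
      exact (palindrome_map_range_iff u k l).2 h

theorem exists_isPalindromicFactor {α : Type*} (u : ℕ → α) {n : ℕ} (hn : 0 < n) :
    ∃ k < n, IsPalindromicFactor u k n ∧
      prefixPalindromicLength u k + 1 ≤ prefixPalindromicLength u n := by
  obtain ⟨L, hL, hflat, hpal⟩ := (palindromicLength_isLeast (wordPrefix u n)).1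
  rcases List.eq_nil_or_concat L with rfl | ⟨L', P, rfl⟩
  · have := congrArg List.length hflat
    simp [wordPrefix] at this
    omega
  rw [List.concat_eq_append] at hL hflat hpal
  have hlen : L'.flatten.length + P.length = n := by
    have := congrArg List.length hflat
    simpa [wordPrefix] using this
  rw [← hlen, wordPrefix_add, List.flatten_append, List.flatten_singleton] at hflat
  obtain ⟨h1, h2⟩ := List.append_inj hflat (by simp [wordPrefix])
  have hle : prefixPalindromicLength u L'.flatten.length ≤ L'.length :=
    (palindromicLength_isLeast _).2 ⟨L', rfl, h1, fun Q hQ => hpal Q (by simp [hQ])⟩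
  have hL' : L'.length + 1 = prefixPalindromicLength u n := by
    simpa [prefixPalindromicLength] using hL
  refine ⟨L'.flatten.length, ?_, ?_, by omega⟩
  -- If the last palindrome were empty, dropping it would contradict minimality.
  · rcases Nat.eq_zero_or_pos P.length with h0 | h0
    · have : L'.flatten.length = n := by omega
      rw [this] at hle
      omega
    · omega
  · have := hpal P (by simp)
    rw [h2] at this
    rw [← hlen]
    exact (palindrome_map_range_iff u _ _).1 this

/-! ### The infinite word of `ψ` and the partial sums of its coding -/

/-- The position of a letter in the list of the alphabet. -/
def DiffLetter.toFin : DiffLetter → Fin 10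
  | .A => 0 | .B => 1 | .C => 2 | .D => 3 | .Abar => 4 | .Bbar => 5 | .Cbar => 6 | .Dbar => 7
  | .S => 8 | .Sprime => 9

theorem DiffLetter.toFin_injective : Function.Injective DiffLetter.toFin := by
  intro y z h
  cases y <;> cases z <;> first | rfl | exact absurd h (by decide)

/-- Together with finiteness, this lets `decide` check the properties of the tables below. -/
instance : DecidableEq DiffLetter := fun _ _ => decidable_of_iff _ DiffLetter.toFin_injective.eq_iff

instance : Fintype DiffLetter where
  elems := {.A, .B, .C, .D, .Abar, .Bbar, .Cbar, .Dbar, .S, .Sprime}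
  complete y := by cases y <;> decide

/-- The letter of index `r` of `ψ(y)`. -/
def psiLetter (y : DiffLetter) (r : ℕ) : DiffLetter := (psi y).getD r .A

/-- The coding with values in `ℤ`. -/
def weight : DiffLetter → ℤ
  | .A | .B | .C | .D => 1
  | .Abar | .Bbar | .Cbar | .Dbar => -1
  | .S | .Sprime => 0

theorem coding_eq_weight (y : DiffLetter) : ((coding y : SignType) : ℤ) = weight y := by
  cases y <;> rfl

/-- The letters whose image under the projection to the Sierpinski word is `b`. -/
def isB : DiffLetter → Bool
  | .B | .Bbar | .S => true
  | _ => false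

theorem psi_uniform : IsUniformMorphism 3 psi := fun y => by cases y <;> rfl

/-- The word `ψ^∞(A)`. -/
def psiWord : ℕ → DiffLetter := morphicWord psi .A

theorem psiWord_mul_add (n : ℕ) {r : ℕ} (hr : r < 3) :
    psiWord (3 * n + r) = psiLetter (psiWord n) r := by
  have h := morphicWord_mul_add (by norm_num) psi_uniform (a := .A) ⟨[.B, .Cbar], rfl⟩ n hr
  rw [psiLetter, List.getD_eq_getElem?_getD]
  change (psi (psiWord n))[r]? = some (psiWord (3 * n + r)) at h
  rw [h]
  rfl

theorem psiWord_mul (n : ℕ) : psiWord (3 * n) = psiLetter (psiWord n) 0 :=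
  psiWord_mul_add n (r := 0) (by norm_num)

theorem psiWord_mul_add_one (n : ℕ) : psiWord (3 * n + 1) = psiLetter (psiWord n) 1 :=
  psiWord_mul_add n (by norm_num)

theorem psiWord_mul_add_two (n : ℕ) : psiWord (3 * n + 2) = psiLetter (psiWord n) 2 :=
  psiWord_mul_add n (by norm_num)

theorem psiWord_zero : psiWord 0 = .A := rfl

/-- The sum of the codes of the first `n` letters of `ψ^∞(A)`. -/
def psiSum (n : ℕ) : ℤ := ∑ i ∈ Finset.range n, weight (psiWord i)

theorem psiSum_zero : psiSum 0 = 0 := rfl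

theorem psiSum_succ (n : ℕ) : psiSum (n + 1) = psiSum n + weight (psiWord n) :=
  Finset.sum_range_succ _ _

/-- This conservation law makes `psiSum` invariant under n ↦ 3n. -/
theorem weight_psi (y : DiffLetter) :
    weight (psiLetter y 0) + weight (psiLetter y 1) + weight (psiLetter y 2) = weight y := by
  cases y <;> rfl

theorem psiSum_mul (n : ℕ) : psiSum (3 * n) = psiSum n := by
  induction n with
  | zero => rfl
  | succ n ih =>
    rw [show 3 * (n + 1) = 3 * n + 2 + 1 by ring, psiSum_succ, psiSum_succ, psiSum_succ, ih,
      psiWord_mul, psiWord_mul_add_one, psiWord_mul_add_two, psiSum_succ, ← weight_psi (psiWord n)]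
    ring

theorem psiSum_mul_add_one (n : ℕ) :
    psiSum (3 * n + 1) = psiSum n + weight (psiLetter (psiWord n) 0) := by
  rw [psiSum_succ, psiSum_mul, psiWord_mul]

theorem psiSum_mul_add_two (n : ℕ) :
    psiSum (3 * n + 2) =
      psiSum n + weight (psiLetter (psiWord n) 0) + weight (psiLetter (psiWord n) 1) := by
  rw [psiSum_succ, psiSum_mul_add_one, psiWord_mul_add_one]

theorem psiSum_mul_add_three (n : ℕ) : psiSum (3 * n + 3) = psiSum (n + 1) :=
  psiSum_mul (n + 1)

/-- The two-letter factors of `ψ^∞(A)`. -/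
def consecutive : DiffLetter → List DiffLetter
  | .A => [.B]
  | .B => [.S, .Cbar, .Dbar]
  | .C => [.Bbar]
  | .D => [.S, .Bbar]
  | .Abar => [.B]
  | .Bbar => [.A, .C, .Abar]
  | .Cbar => [.B]
  | .Dbar => [.S]
  | .S => [.S, .D, .Bbar, .Dbar, .Sprime]
  | .Sprime => [.S]

/-- Two adjacent letters lie inside one block ψ(y) or straddle the blocks of two adjacent letters;
the table contains the former pairs and is closed under the latter. -/
theorem psiWord_succ_mem (n : ℕ) : psiWord (n + 1) ∈ consecutive (psiWord n) := by
  induction n using Nat.strong_induction_on with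
  | _ n ih =>
    obtain ⟨m, rfl | rfl | rfl⟩ : ∃ m, n = 3 * m ∨ n = 3 * m + 1 ∨ n = 3 * m + 2 :=
      ⟨n / 3, by omega⟩
    · rw [psiWord_mul, psiWord_mul_add_one]
      generalize psiWord m = y
      revert y; decide
    · rw [psiWord_mul_add_one, psiWord_mul_add_two]
      generalize psiWord m = y
      revert y; decide
    · rw [show 3 * m + 2 + 1 = 3 * (m + 1) by ring, psiWord_mul_add_two, psiWord_mul]
      have h := ih m (by omega)
      generalize psiWord m = y at h ⊢
      generalize psiWord (m + 1) = z at h ⊢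
      revert y z; decide

/-! ### The Sierpinski word as a coding of `ψ^∞(A)` -/

/-- The coding that maps `ψ^∞(A)` to the Sierpinski word. -/
def toSierpinski (y : DiffLetter) : SierpinskiLetter := if isB y then .b else .a

theorem sierpinskiMorphism_toSierpinski (y : DiffLetter) :
    sierpinskiMorphism (toSierpinski y) = (psi y).map toSierpinski := by
  cases y <;> rfl

theorem sierpinskiWord_eq (n : ℕ) : sierpinskiWord n = toSierpinski (psiWord n) := by
  induction n using Nat.strong_induction_on with
  | _ n ih =>
    rcases Nat.eq_zero_or_pos n with rfl | hn
    · rfl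
    have hu : IsUniformMorphism 3 sierpinskiMorphism := fun y => by cases y <;> rfl
    have h := morphicWord_mul_add (by norm_num) hu (a := .a) ⟨[.b, .a], rfl⟩ (n / 3)
      (Nat.mod_lt n (by norm_num))
    have h' := morphicWord_mul_add (by norm_num) psi_uniform (a := .A) ⟨[.B, .Cbar], rfl⟩ (n / 3)
      (Nat.mod_lt n (by norm_num))
    rw [Nat.div_add_mod] at h h'
    change (sierpinskiMorphism (sierpinskiWord (n / 3)))[n % 3]? = some (sierpinskiWord n) at h
    change (psi (psiWord (n / 3)))[n % 3]? = some (psiWord n) at h'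
    rw [ih (n / 3) (by omega), sierpinskiMorphism_toSierpinski, List.getElem?_map, h'] at h
    exact (Option.some.inj h).symm

theorem toSierpinski_eq_iff {y z : DiffLetter} : toSierpinski y = toSierpinski z ↔ isB y = isB z := by
  cases y <;> cases z <;> simp [toSierpinski, isB]

theorem isB_psi (y : DiffLetter) :
    isB (psiLetter y 0) = isB y ∧ isB (psiLetter y 1) = true ∧ isB (psiLetter y 2) = isB y := by
  cases y <;> decide

/-- The letter of index `n` of the Sierpinski word is `b`. -/
def sierpinskiB (n : ℕ) : Bool := isB (psiWord n)

theorem sierpinskiB_mul (n : ℕ) : sierpinskiB (3 * n) = sierpinskiB n := by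
  rw [sierpinskiB, psiWord_mul, (isB_psi _).1, sierpinskiB]

theorem sierpinskiB_mul_add_one (n : ℕ) : sierpinskiB (3 * n + 1) = true := by
  rw [sierpinskiB, psiWord_mul_add_one, (isB_psi _).2.1]

theorem sierpinskiB_mul_add_two (n : ℕ) : sierpinskiB (3 * n + 2) = sierpinskiB n := by
  rw [sierpinskiB, psiWord_mul_add_two, (isB_psi _).2.2, sierpinskiB]

theorem isPalindromicFactor_sierpinskiWord_iff {k n : ℕ} :
    IsPalindromicFactor sierpinskiWord k n ↔ IsPalindromicFactor sierpinskiB k n := by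
  simp only [IsPalindromicFactor, sierpinskiWord_eq, toSierpinski_eq_iff, sierpinskiB]

/-! ### Palindromic factors of the Sierpinski word -/

theorem IsPalindromicFactor.shrink {α : Type*} {u : ℕ → α} {k n : ℕ}
    (h : IsPalindromicFactor u k (n + 1)) : IsPalindromicFactor u (k + 1) n :=
  fun i j hij hi hj => h i j (by omega) (by omega) (by omega)

theorem isPalindromicFactor_succ {α : Type*} (u : ℕ → α) (n : ℕ) :
    IsPalindromicFactor u n (n + 1) := fun i j hij hi hj => by
  rw [show i = j by omega]

theorem isPalindromicFactor_of_forall {α : Type*} {u : ℕ → α} {c : α} {k n : ℕ}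
    (h : ∀ i, k ≤ i → i < n → u i = c) : IsPalindromicFactor u k n := fun i j hij hi hj => by
  rw [h i hi (by omega), h j hj (by omega)]

/-- The blocks aba and bbb are palindromes, so the Sierpinski morphism commutes with reversal. -/
theorem IsPalindromicFactor.mul_three {k n : ℕ} (h : IsPalindromicFactor sierpinskiB k n) :
    IsPalindromicFactor sierpinskiB (3 * k) (3 * n) := by
  intro i j hij hi hj
  obtain ⟨m, rfl | rfl | rfl⟩ : ∃ m, i = 3 * m ∨ i = 3 * m + 1 ∨ i = 3 * m + 2 := ⟨i / 3, by omega⟩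
  · obtain ⟨l, rfl⟩ : ∃ l, j = 3 * l + 2 := ⟨j / 3, by omega⟩
    rw [sierpinskiB_mul, sierpinskiB_mul_add_two]
    exact h _ _ (by omega) (by omega) (by omega)
  · obtain ⟨l, rfl⟩ : ∃ l, j = 3 * l + 1 := ⟨j / 3, by omega⟩
    rw [sierpinskiB_mul_add_one, sierpinskiB_mul_add_one]
  · obtain ⟨l, rfl⟩ : ∃ l, j = 3 * l := ⟨j / 3, by omega⟩
    rw [sierpinskiB_mul, sierpinskiB_mul_add_two]
    exact h _ _ (by omega) (by omega) (by omega)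

/-- Of two mirror blocks, the corner letters that face the centre survive the cut of r letters at
both ends, and each determines its block. -/
theorem IsPalindromicFactor.of_mul_three {k n r : ℕ} (hr : r < 3)
    (h : IsPalindromicFactor sierpinskiB (3 * k + r) (3 * n + 3 - r)) :
    IsPalindromicFactor sierpinskiB k (n + 1) := by
  intro i j hij hi hj
  rcases lt_trichotomy i j with hlt | rfl | hlt
  · rw [← sierpinskiB_mul_add_two i, ← sierpinskiB_mul j]
    exact h _ _ (by omega) (by omega) (by omega)
  · rfl
  · rw [← sierpinskiB_mul_add_two j, ← sierpinskiB_mul i]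
    exact h _ _ (by omega) (by omega) (by omega)

theorem exists_sierpinskiB_false {n : ℕ} (h : sierpinskiB n = false) :
    ∃ m, sierpinskiB m = false ∧ (n = 3 * m ∨ n = 3 * m + 2) := by
  obtain ⟨m, rfl | rfl | rfl⟩ : ∃ m, n = 3 * m ∨ n = 3 * m + 1 ∨ n = 3 * m + 2 := ⟨n / 3, by omega⟩
  · exact ⟨m, by rwa [sierpinskiB_mul] at h, .inl rfl⟩
  · rw [sierpinskiB_mul_add_one] at h; cases h
  · exact ⟨m, by rwa [sierpinskiB_mul_add_two] at h, .inr rfl⟩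

/-- A palindromic factor of length at least two that is not aligned with the blocks of length
three is a power of `b` or the word `bab`. -/
theorem IsPalindromicFactor.unaligned {k n : ℕ} (h : IsPalindromicFactor sierpinskiB k (n + 1))
    (hkn : k < n) (h3 : (k + n) % 3 ≠ 2) :
    (∀ i, k ≤ i → i ≤ n → sierpinskiB i = true) ∨
      (n = k + 2 ∧ sierpinskiB (k + 1) = false ∧ sierpinskiB (k + 2) = true) := by
  by_contra! hcon
  obtain ⟨⟨i, hki, hin, hi⟩, hbab⟩ := hcon
  simp only [ne_eq, Bool.not_eq_true] at hi
  have hj := (h (k + n - i) i (by omega) (by omega) hki).trans hi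
  obtain ⟨i', hi', hi''⟩ := exists_sierpinskiB_false hi
  obtain ⟨j', hj', hj''⟩ := exists_sierpinskiB_false hj
  -- A letter a has index 0 or 2 modulo 3, so by `h3` the indices of this a and of its mirror image
  -- are congruent. The other corner of either block is also an a, but its mirror position is 1
  -- modulo 3, where only b occurs. Hence both other corners lie outside the factor, which leaves
  -- only the centre of a factor of length three.
  have key : n = k + 2 ∧ i = k + 1 := by
    rcases hi'' with hi'' | hi''
    · have h0 : k + n - i = 3 * j' := by omega
      by_cases hlt : i + 2 ≤ n
      · have := (h (k + n - i - 2) (i + 2) (by omega) (by omega) (by omega)).trans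
          ((congrArg sierpinskiB (by omega : i + 2 = 3 * i' + 2)).trans
            ((sierpinskiB_mul_add_two _).trans hi'))
        obtain ⟨l, -, hl⟩ := exists_sierpinskiB_false this
        omega
      by_cases hlt' : k + n - i + 2 ≤ n
      · have := (h (i - 2) (k + n - i + 2) (by omega) (by omega) (by omega)).trans
          ((congrArg sierpinskiB (by omega : k + n - i + 2 = 3 * j' + 2)).trans
            ((sierpinskiB_mul_add_two _).trans hj'))
        obtain ⟨l, -, hl⟩ := exists_sierpinskiB_false this
        omega
      omega
    · have h0 : k + n - i = 3 * j' + 2 := by omega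
      by_cases hlt : k + 2 ≤ i
      · have := (h (k + n - i + 2) (i - 2) (by omega) (by omega) (by omega)).trans
          ((congrArg sierpinskiB (by omega : i - 2 = 3 * i')).trans
            ((sierpinskiB_mul _).trans hi'))
        obtain ⟨l, -, hl⟩ := exists_sierpinskiB_false this
        omega
      by_cases hlt' : k + 2 ≤ k + n - i
      · have := (h (i + 2) (k + n - i - 2) (by omega) (by omega) (by omega)).trans
          ((congrArg sierpinskiB (by omega : k + n - i - 2 = 3 * j')).trans
            ((sierpinskiB_mul _).trans hj'))
        obtain ⟨l, -, hl⟩ := exists_sierpinskiB_false this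
        omega
      omega
  obtain ⟨rfl, rfl⟩ := key
  refine hbab rfl hi ?_
  by_contra hne
  simp only [Bool.not_eq_true] at hne
  obtain ⟨l, -, hl⟩ := exists_sierpinskiB_false hne
  have := (h k (k + 2) (by omega) (by omega) (by omega)).trans hne
  obtain ⟨l', -, hl'⟩ := exists_sierpinskiB_false this
  omega

/-! ### The sums of codes over palindromic factors -/

/-- The possible values of the sum of the codes of a factor of `ψ^∞(A)` that starts with `y`, ends
with `z` and lies over a palindrome. -/
def palindromicSums : DiffLetter → DiffLetter → List ℤ
  | .A, .A => [1] | .A, .Abar => [-1, 1] | .A, .Cbar => [1] | .A, .Dbar => [1]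
  | .B, .B => [1] | .B, .Bbar => [-1, 1] | .B, .S => [0, 1]
  | .C, .C => [1] | .C, .Abar => [-1] | .C, .Cbar => [-1, 1] | .C, .Dbar => [1]
  | .C, .Sprime => [1]
  | .D, .D => [1] | .D, .Abar => [-1] | .D, .Cbar => [-1] | .D, .Dbar => [-1, 0, 1]
  | .D, .Sprime => [0, 1]
  | .Abar, .A => [-1, 1] | .Abar, .C => [1] | .Abar, .D => [1] | .Abar, .Abar => [-1]
  | .Bbar, .B => [-1, 1] | .Bbar, .Bbar => [-1] | .Bbar, .S => [0]
  | .Cbar, .A => [-1] | .Cbar, .C => [-1, 1] | .Cbar, .D => [1] | .Cbar, .Cbar => [-1]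
  | .Cbar, .Sprime => [0]
  | .Dbar, .A => [-1] | .Dbar, .C => [-1] | .Dbar, .D => [-1, 0, 1] | .Dbar, .Dbar => [-1]
  | .Dbar, .Sprime => [-1, 0]
  | .S, .B => [0] | .S, .Bbar => [-1, 0] | .S, .S => [-1, 0, 1]
  | .Sprime, .C => [0] | .Sprime, .D => [0, 1] | .Sprime, .Cbar => [-1] | .Sprime, .Dbar => [-1, 0]
  | .Sprime, .Sprime => [-1, 0, 1]
  | _, _ => []

theorem palindromicSums_le : ∀ y z, ∀ d ∈ palindromicSums y z, d ≤ 1 := by decide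

theorem palindromicSums_self : ∀ y, weight y ∈ palindromicSums y y := by decide

/-- This and the next two checks are the closure of the table under ψ followed by a cut of 0, 1 or 2
letters at both ends. -/
theorem palindromicSums_psi_zero : ∀ y z, ∀ d ∈ palindromicSums y z,
    d ∈ palindromicSums (psiLetter y 0) (psiLetter z 2) := by decide

theorem palindromicSums_psi_one : ∀ y z, ∀ d ∈ palindromicSums y z,
    d - weight (psiLetter y 0) - weight (psiLetter z 2) ∈
      palindromicSums (psiLetter y 1) (psiLetter z 1) := by decide

theorem palindromicSums_psi_two : ∀ y z, ∀ d ∈ palindromicSums y z,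
    d - weight (psiLetter y 0) - weight (psiLetter y 1) - weight (psiLetter z 1)
      - weight (psiLetter z 2) ∈ palindromicSums (psiLetter y 2) (psiLetter z 0) := by decide

/-- The possible values of the sum of the codes of a factor of `ψ^∞(A)` of length at least two
that starts with `y`, ends with `z` and lies over a power of `b`. -/
def runSums : DiffLetter → DiffLetter → List ℤ
  | .B, .S => [1]
  | .S, .S => [0]
  | .S, .Bbar => [-1]
  | _, _ => []

theorem runSums_subset : ∀ y z, ∀ d ∈ runSums y z, d ∈ palindromicSums y z := by decide

/-- The lists give the three possible cuts at the start and at the end, each with the extreme letter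
that remains and the code removed. Unlike for aligned palindromes, the two cuts are independent. -/
theorem runSums_psi : ∀ y z, ∀ d ∈ runSums y z,
    ∀ e ∈ [(psiLetter y 0, (0 : ℤ)), (psiLetter y 1, weight (psiLetter y 0)),
      (psiLetter y 2, weight (psiLetter y 0) + weight (psiLetter y 1))],
    ∀ f ∈ [(psiLetter z 2, (0 : ℤ)), (psiLetter z 1, weight (psiLetter z 2)),
      (psiLetter z 0, weight (psiLetter z 1) + weight (psiLetter z 2))],
    d - e.2 - f.2 ∈ runSums e.1 f.1 := by decide

theorem runSums_block : ∀ y, isB y = true →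
    weight (psiLetter y 0) + weight (psiLetter y 1) ∈ runSums (psiLetter y 0) (psiLetter y 1) ∧
    weight y ∈ runSums (psiLetter y 0) (psiLetter y 2) ∧
    weight (psiLetter y 1) + weight (psiLetter y 2) ∈
      runSums (psiLetter y 1) (psiLetter y 2) := by decide

theorem psiSum_mul_add_two' (n : ℕ) :
    psiSum (3 * n + 2) = psiSum (n + 1) - weight (psiLetter (psiWord n) 2) := by
  rw [psiSum_mul_add_two, psiSum_succ, ← weight_psi (psiWord n)]
  ring

theorem psiSum_mul_add_one' (n : ℕ) :
    psiSum (3 * n + 1) = psiSum (n + 1) -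
      (weight (psiLetter (psiWord n) 1) + weight (psiLetter (psiWord n) 2)) := by
  rw [psiSum_mul_add_one, psiSum_succ, ← weight_psi (psiWord n)]
  ring

theorem exists_start_offset (k : ℕ) :
    ∃ e ∈ [(psiLetter (psiWord (k / 3)) 0, (0 : ℤ)),
      (psiLetter (psiWord (k / 3)) 1, weight (psiLetter (psiWord (k / 3)) 0)),
      (psiLetter (psiWord (k / 3)) 2, weight (psiLetter (psiWord (k / 3)) 0) +
        weight (psiLetter (psiWord (k / 3)) 1))],
      psiWord k = e.1 ∧ psiSum k = psiSum (k / 3) + e.2 := by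
  obtain ⟨m, hm⟩ : ∃ m, m = k / 3 := ⟨_, rfl⟩
  rw [← hm]
  obtain rfl | rfl | rfl : k = 3 * m ∨ k = 3 * m + 1 ∨ k = 3 * m + 2 := by omega
  · exact ⟨_, .head _, psiWord_mul m, by simp [psiSum_mul]⟩
  · exact ⟨_, .tail _ (.head _), psiWord_mul_add_one m, psiSum_mul_add_one m⟩
  · exact ⟨_, .tail _ (.tail _ (.head _)), psiWord_mul_add_two m,
      by rw [psiSum_mul_add_two, add_assoc]⟩

theorem exists_end_offset (n : ℕ) :
    ∃ f ∈ [(psiLetter (psiWord (n / 3)) 2, (0 : ℤ)),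
      (psiLetter (psiWord (n / 3)) 1, weight (psiLetter (psiWord (n / 3)) 2)),
      (psiLetter (psiWord (n / 3)) 0, weight (psiLetter (psiWord (n / 3)) 1) +
        weight (psiLetter (psiWord (n / 3)) 2))],
      psiWord n = f.1 ∧ psiSum (n + 1) = psiSum (n / 3 + 1) - f.2 := by
  obtain ⟨m, hm⟩ : ∃ m, m = n / 3 := ⟨_, rfl⟩
  rw [← hm]
  obtain rfl | rfl | rfl : n = 3 * m + 2 ∨ n = 3 * m + 1 ∨ n = 3 * m := by omega
  · exact ⟨_, .head _, psiWord_mul_add_two m, by simp [psiSum_mul_add_three]⟩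
  · exact ⟨_, .tail _ (.head _), psiWord_mul_add_one m, psiSum_mul_add_two' m⟩
  · exact ⟨_, .tail _ (.tail _ (.head _)), psiWord_mul m, psiSum_mul_add_one' m⟩

/-- A run that meets several blocks contains a corner of each of them: the last letter of its first
block, the first letter of the others. -/
theorem sierpinskiB_div_three {k n i : ℕ} (h : ∀ i, k ≤ i → i ≤ n → sierpinskiB i = true)
    (hlt : k / 3 < n / 3) (hki : k / 3 ≤ i) (hin : i ≤ n / 3) : sierpinskiB i = true := by
  rcases hki.eq_or_lt with rfl | hki
  · rw [← sierpinskiB_mul_add_two]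
    exact h _ (by omega) (by omega)
  · rw [← sierpinskiB_mul]
    exact h _ (by omega) (by omega)

theorem psiSum_sub_mem_runSums {k n : ℕ} (hkn : k < n)
    (h : ∀ i, k ≤ i → i ≤ n → sierpinskiB i = true) :
    psiSum (n + 1) - psiSum k ∈ runSums (psiWord k) (psiWord n) := by
  induction n using Nat.strong_induction_on generalizing k with
  | _ n ih =>
    rcases (Nat.div_le_div_right (c := 3) hkn.le).eq_or_lt with heq | hlt
    · obtain ⟨m, hm⟩ : ∃ m, m = n / 3 := ⟨_, rfl⟩
      -- Two distinct positions in one block include a corner, which carries the letter of index m.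
      have hB : sierpinskiB m = true := by
        by_cases h0 : k = 3 * m
        · rw [← sierpinskiB_mul, ← h0]
          exact h k le_rfl hkn.le
        · rw [← sierpinskiB_mul_add_two]
          exact h _ (by omega) (by omega)
      obtain ⟨h1, h2, h3⟩ := runSums_block _ hB
      obtain ⟨rfl, rfl⟩ | ⟨rfl, rfl⟩ | ⟨rfl, rfl⟩ : (k = 3 * m ∧ n = 3 * m + 1) ∨
          (k = 3 * m ∧ n = 3 * m + 2) ∨ (k = 3 * m + 1 ∧ n = 3 * m + 2) := by omega
      · rw [psiSum_mul_add_two, psiSum_mul, psiWord_mul, psiWord_mul_add_one]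
        convert h1 using 1
        ring
      · rw [psiSum_mul_add_three, psiSum_mul, psiWord_mul, psiWord_mul_add_two, psiSum_succ]
        convert h2 using 1
        ring
      · rw [psiSum_mul_add_three, psiSum_mul_add_one, psiWord_mul_add_one, psiWord_mul_add_two,
          psiSum_succ, ← weight_psi (psiWord m)]
        convert h3 using 1
        ring
    · have hrec := ih (n / 3) (by omega) hlt fun i => sierpinskiB_div_three h hlt
      obtain ⟨e, he, he1, he2⟩ := exists_start_offset k
      obtain ⟨f, hf, hf1, hf2⟩ := exists_end_offset n
      have := runSums_psi _ _ _ hrec e he f hf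
      rw [he1, he2, hf1, hf2]
      convert this using 1
      ring

/-- The central a of bab is a corner of its block, so an unaligned bab straddles two blocks. Here
the a closes the first block; in the next check it opens the second. -/
theorem psiSum_bab_mem : ∀ y, ∀ z ∈ consecutive y, isB y = false → isB z = true →
    weight (psiLetter y 1) + weight (psiLetter y 2) + weight (psiLetter z 0) ∈
      palindromicSums (psiLetter y 1) (psiLetter z 0) := by decide

theorem psiSum_bab_mem' : ∀ y, ∀ z ∈ consecutive y, isB y = true → isB z = false →
    weight (psiLetter y 2) + weight (psiLetter z 0) + weight (psiLetter z 1) ∈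
      palindromicSums (psiLetter y 2) (psiLetter z 1) := by decide

theorem IsPalindromicFactor.psiSum_sub_mem {k n : ℕ} (hkn : k ≤ n)
    (h : IsPalindromicFactor sierpinskiB k (n + 1)) :
    psiSum (n + 1) - psiSum k ∈ palindromicSums (psiWord k) (psiWord n) := by
  induction n using Nat.strong_induction_on generalizing k with
  | _ n ih =>
    rcases hkn.eq_or_lt with rfl | hlt
    · rw [psiSum_succ, add_sub_cancel_left]
      exact palindromicSums_self _
    by_cases h3 : (k + n) % 3 = 2
    · obtain ⟨l, hl⟩ : ∃ l, l = k / 3 := ⟨_, rfl⟩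
      obtain ⟨m, hm⟩ : ∃ m, m = n / 3 := ⟨_, rfl⟩
      obtain ⟨rfl, rfl⟩ | ⟨rfl, rfl⟩ | ⟨rfl, rfl⟩ : (k = 3 * l ∧ n = 3 * m + 2) ∨
          (k = 3 * l + 1 ∧ n = 3 * m + 1) ∨ (k = 3 * l + 2 ∧ n = 3 * m) := by omega
      · have := palindromicSums_psi_zero _ _ _
          (ih m (by omega) (by omega) (IsPalindromicFactor.of_mul_three (r := 0) (by norm_num) h))
        rwa [psiSum_mul_add_three, psiSum_mul, psiWord_mul, psiWord_mul_add_two]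
      · have := palindromicSums_psi_one _ _ _
          (ih m (by omega) (by omega) (IsPalindromicFactor.of_mul_three (r := 1) (by norm_num) h))
        rw [psiSum_mul_add_two', psiSum_mul_add_one, psiWord_mul_add_one, psiWord_mul_add_one]
        convert this using 1
        ring
      · have := palindromicSums_psi_two _ _ _
          (ih m (by omega) (by omega) (IsPalindromicFactor.of_mul_three (r := 2) (by norm_num) h))
        rw [psiSum_mul_add_one', psiSum_mul_add_two, psiWord_mul, psiWord_mul_add_two]
        convert this using 1
        ring
    rcases h.unaligned hlt h3 with hrun | ⟨rfl, hA, hB⟩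
    · exact runSums_subset _ _ _ (psiSum_sub_mem_runSums hlt hrun)
    · obtain ⟨m, rfl | rfl⟩ : ∃ m, k = 3 * m + 1 ∨ k = 3 * m + 2 := ⟨k / 3, by omega⟩
      · rw [show 3 * m + 1 + 1 = 3 * m + 2 by ring, sierpinskiB_mul_add_two] at hA
        rw [show 3 * m + 1 + 2 = 3 * (m + 1) by ring, sierpinskiB_mul] at hB
        have := psiSum_bab_mem _ _ (psiWord_succ_mem m) hA hB
        rw [show 3 * m + 1 + 2 = 3 * (m + 1) by ring, psiSum_mul_add_one, psiSum_mul_add_one,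
          psiWord_mul, psiWord_mul_add_one, psiSum_succ, ← weight_psi (psiWord m)]
        convert this using 1
        ring
      · rw [show 3 * m + 2 + 1 = 3 * (m + 1) by ring, sierpinskiB_mul] at hA
        have hB' : sierpinskiB m = true := by
          rw [← sierpinskiB_mul_add_two,
            h (3 * m + 2) (3 * m + 2 + 2) (by omega) (by omega) (by omega), hB]
        have := psiSum_bab_mem' _ _ (psiWord_succ_mem m) hB' hA
        rw [show 3 * m + 2 + 2 = 3 * (m + 1) + 1 by ring, psiSum_mul_add_two, psiSum_mul_add_two,
          psiWord_mul_add_one, psiWord_mul_add_two, psiSum_succ, ← weight_psi (psiWord m)]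
        convert this using 1
        ring

/-! ### The lower bound -/

theorem IsPalindromicFactor.psiSum_le {k n : ℕ} (hkn : k < n)
    (h : IsPalindromicFactor sierpinskiB k n) : psiSum n ≤ psiSum k + 1 := by
  obtain ⟨n, rfl⟩ : ∃ m, n = m + 1 := ⟨n - 1, by omega⟩
  have := palindromicSums_le _ _ _ (h.psiSum_sub_mem (by omega))
  omega

theorem psiSum_le_sierpinskiPPL (n : ℕ) : psiSum n ≤ sierpinskiPPL n := by
  induction n using Nat.strong_induction_on with
  | _ n ih =>
    rcases Nat.eq_zero_or_pos n with rfl | hn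
    · rw [psiSum_zero]
      exact Int.natCast_nonneg _
    obtain ⟨k, hk, hpal, hle⟩ := exists_isPalindromicFactor sierpinskiWord hn
    have h1 := (isPalindromicFactor_sierpinskiWord_iff.1 hpal).psiSum_le hk
    have h2 := ih k hk
    rw [sierpinskiPPL] at h2 ⊢
    omega

/-! ### Short palindromic factorizations of prefixes -/

/-- Some palindromic factor whose last letter has index `n` has the code sum `t.2` and lies under a
factor of `ψ^∞(A)` that starts with `t.1`. -/
def HasPalindromicSuffix (n : ℕ) (t : DiffLetter × ℤ) : Prop :=
  ∃ k ≤ n, IsPalindromicFactor sierpinskiB k (n + 1) ∧ psiWord k = t.1 ∧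
    psiSum (n + 1) = psiSum k + t.2

/-- The letter of index `n` is a letter `S` in a run of letters `b` that starts with `B`. -/
def InRunFromB (n : ℕ) : Prop :=
  psiWord n = .S ∧ ∃ k < n, (∀ i, k ≤ i → i ≤ n → sierpinskiB i = true) ∧
    psiSum (n + 1) = psiSum k + 1

theorem hasPalindromicSuffix_self (n : ℕ) :
    HasPalindromicSuffix n (psiWord n, weight (psiWord n)) :=
  ⟨n, le_rfl, isPalindromicFactor_succ _ n, rfl, psiSum_succ n⟩

theorem HasPalindromicSuffix.psi_two {n : ℕ} {t : DiffLetter × ℤ} (h : HasPalindromicSuffix n t) :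
    HasPalindromicSuffix (3 * n + 2) (psiLetter t.1 0, t.2) := by
  obtain ⟨k, hk, hpal, ht, hs⟩ := h
  refine ⟨3 * k, by omega, hpal.mul_three, ?_, ?_⟩
  · rw [psiWord_mul, ht]
  · rw [psiSum_mul_add_three, psiSum_mul, hs]

theorem HasPalindromicSuffix.psi_one {n : ℕ} {t : DiffLetter × ℤ} (h : HasPalindromicSuffix n t) :
    HasPalindromicSuffix (3 * n + 1) (psiLetter t.1 1,
      t.2 - weight (psiLetter t.1 0) - weight (psiLetter (psiWord n) 2)) := by
  obtain ⟨k, hk, hpal, ht, hs⟩ := h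
  refine ⟨3 * k + 1, by omega, hpal.mul_three.shrink, ?_, ?_⟩
  · rw [psiWord_mul_add_one, ht]
  · rw [psiSum_mul_add_two', psiSum_mul_add_one, hs, ht]
    ring

/-- The image of a single letter is too short to lose two letters at both ends; `hne` excludes that
case. -/
theorem HasPalindromicSuffix.psi_zero {n : ℕ} {t : DiffLetter × ℤ} (h : HasPalindromicSuffix n t)
    (hne : t ≠ (psiWord n, weight (psiWord n))) :
    HasPalindromicSuffix (3 * n) (psiLetter t.1 2,
      t.2 - weight (psiLetter t.1 0) - weight (psiLetter t.1 1)
        - weight (psiLetter (psiWord n) 1) - weight (psiLetter (psiWord n) 2)) := by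
  obtain ⟨k, hk, hpal, ht, hs⟩ := h
  have hkn : k ≠ n := by
    rintro rfl
    refine hne (Prod.ext ht.symm ?_)
    rw [psiSum_succ] at hs
    exact (add_left_cancel hs).symm
  refine ⟨3 * k + 2, by omega, hpal.mul_three.shrink.shrink, ?_, ?_⟩
  · rw [psiWord_mul_add_two, ht]
  · rw [psiSum_mul_add_one', psiSum_mul_add_two, hs, ht]
    ring

theorem sierpinskiB_of_div_three {i : ℕ} (h : sierpinskiB (i / 3) = true) :
    sierpinskiB i = true := by
  by_contra hi
  rw [Bool.not_eq_true] at hi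
  obtain ⟨m, hm, him⟩ := exists_sierpinskiB_false hi
  rw [show i / 3 = m by omega, hm] at h
  cases h

/-- The run keeps its full start 3k, and the letters of ψ(S) = SSS have code 0, so the sum stays 1.
-/
theorem InRunFromB.psi {n r : ℕ} (h : InRunFromB n) (hr : r < 3) : InRunFromB (3 * n + r) := by
  obtain ⟨hS, k, hk, hb, hs⟩ := h
  refine ⟨?_, 3 * k, by omega,
    fun i hi hi' => sierpinskiB_of_div_three (hb _ (by omega) (by omega)), ?_⟩
  · rw [psiWord_mul_add n hr, hS]
    interval_cases r <;> rfl
  · rw [psiSum_mul, ← hs]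
    interval_cases r
    · rw [psiSum_mul_add_one', hS]; exact sub_zero _
    · rw [psiSum_mul_add_two', hS]; exact sub_zero _
    · exact psiSum_mul_add_three n

/-- Candidates for the first letter and the code sum of a factor of `ψ^∞(A)` that lies over a
palindrome and ends with a given letter. -/
def suffixCandidates : DiffLetter → List (DiffLetter × ℤ)
  | .A => [(.A, 1)]
  | .B => [(.B, 1)]
  | .C => [(.Cbar, 1)]
  | .D => [(.D, 1)]
  | .Abar => [(.A, 1)]
  | .Bbar => [(.S, 0), (.B, 1)]
  | .Cbar => [(.A, 1)]
  | .Dbar => [(.D, 1)]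
  | .S => [(.S, 1)]
  | .Sprime => [(.D, 1), (.Sprime, 1)]

/-- In this and the next two checks, a candidate for y yields one for each letter of ψ(y), unless a
single letter serves. The letters listed as exceptions are covered by `inRunFromB_of_eq_B` and
`hasPalindromicSuffix_bab`. -/
theorem suffixCandidates_psi_zero : ∀ y, ∀ t ∈ suffixCandidates y,
    (psiLetter y 0, weight (psiLetter y 0)) ∈ suffixCandidates (psiLetter y 0) ∨
    (t ≠ (y, weight y) ∧ (psiLetter t.1 2, t.2 - weight (psiLetter t.1 0)
      - weight (psiLetter t.1 1) - weight (psiLetter y 1) - weight (psiLetter y 2)) ∈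
        suffixCandidates (psiLetter y 0)) := by decide

theorem suffixCandidates_psi_one : ∀ y, ∀ t ∈ suffixCandidates y, y = .B ∨ y = .D ∨ y = .Sprime ∨
    (psiLetter y 1, weight (psiLetter y 1)) ∈ suffixCandidates (psiLetter y 1) ∨
    (psiLetter t.1 1, t.2 - weight (psiLetter t.1 0) - weight (psiLetter y 2)) ∈
      suffixCandidates (psiLetter y 1) := by decide

theorem suffixCandidates_psi_two : ∀ y, ∀ t ∈ suffixCandidates y, y = .B ∨
    (psiLetter t.1 0, t.2) ∈ suffixCandidates (psiLetter y 2) := by decide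

theorem inRunFromB_of_eq_B {n r : ℕ} (h : psiWord n = .B) (hr : r = 1 ∨ r = 2) :
    InRunFromB (3 * n + r) := by
  have hn : sierpinskiB n = true := by rw [sierpinskiB, h]; rfl
  refine ⟨?_, 3 * n, by omega, fun i hi hi' => sierpinskiB_of_div_three ?_, ?_⟩
  · rw [psiWord_mul_add n (by omega), h]
    rcases hr with rfl | rfl <;> rfl
  · rwa [show i / 3 = n by omega]
  · rw [psiSum_mul]
    rcases hr with rfl | rfl
    · rw [psiSum_mul_add_two, h]; simp [psiLetter, psi, weight]
    · rw [psiSum_mul_add_three, psiSum_succ, h]; simp [weight]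

theorem consecutive_D_Sprime : ∀ y z, z ∈ consecutive y → z = .D ∨ z = .Sprime → y = .S := by
  decide

theorem exists_eq_S_of_D_or_Sprime {n : ℕ} (h : psiWord n = .D ∨ psiWord n = .Sprime) :
    ∃ m, n = m + 1 ∧ psiWord m = .S := by
  rcases n with _ | m
  · rw [psiWord_zero] at h
    exact absurd h (by decide)
  · exact ⟨m, rfl, consecutive_D_Sprime _ _ (psiWord_succ_mem m) h⟩

theorem isPalindromicFactor_bab {m : ℕ} (h : psiWord m = .S) :
    IsPalindromicFactor sierpinskiB (3 * m + 2) (3 * (m + 1) + 2) := by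
  have h1 : sierpinskiB (3 * m + 2) = true := by
    rw [sierpinskiB_mul_add_two, sierpinskiB, h]; rfl
  have h2 := sierpinskiB_mul_add_one (m + 1)
  intro i j hij hi hj
  obtain ⟨rfl, rfl⟩ | ⟨rfl, rfl⟩ | ⟨rfl, rfl⟩ : (i = 3 * m + 2 ∧ j = 3 * (m + 1) + 1) ∨
    (i = 3 * (m + 1) ∧ j = 3 * (m + 1)) ∨ (i = 3 * (m + 1) + 1 ∧ j = 3 * m + 2) := by omega
  · rw [h1, h2]
  · rfl
  · rw [h1, h2]

/-- D and S' occur only after S, so their blocks follow a b; the suffix bab lies under S D S, with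
codes 0, 1, 0. -/
theorem hasPalindromicSuffix_bab {n : ℕ} (h : psiWord n = .D ∨ psiWord n = .Sprime) :
    HasPalindromicSuffix (3 * n + 1) (.S, 1) := by
  obtain ⟨m, rfl, hm⟩ := exists_eq_S_of_D_or_Sprime h
  refine ⟨3 * m + 2, by omega, isPalindromicFactor_bab hm, ?_, ?_⟩
  · rw [psiWord_mul_add_two, hm]; rfl
  · rw [psiSum_mul_add_two', psiSum_mul_add_two', hm, psiSum_succ (m + 1)]
    rcases h with h | h <;> rw [h] <;> simp [psiLetter, psi, weight]

theorem exists_suffixCandidate (n : ℕ) :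
    (∃ t ∈ suffixCandidates (psiWord n), HasPalindromicSuffix n t) ∨ InRunFromB n := by
  induction n using Nat.strong_induction_on with
  | _ n ih =>
    rcases Nat.eq_zero_or_pos n with rfl | hn
    · exact .inl ⟨(.A, 1), by decide, hasPalindromicSuffix_self 0⟩
    obtain ⟨m, hm⟩ : ∃ m, m = n / 3 := ⟨_, rfl⟩
    obtain rfl | rfl | rfl : n = 3 * m ∨ n = 3 * m + 1 ∨ n = 3 * m + 2 := by omega
    all_goals rcases ih m (by omega) with ⟨t, ht, h⟩ | h
    · left
      rw [psiWord_mul]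
      rcases suffixCandidates_psi_zero _ t ht with h' | ⟨hne, h'⟩
      · have := hasPalindromicSuffix_self (3 * m)
        rw [psiWord_mul] at this
        exact ⟨_, h', this⟩
      · exact ⟨_, h', h.psi_zero hne⟩
    · exact .inr (h.psi (r := 0) (by norm_num))
    · rcases suffixCandidates_psi_one _ t ht with h' | h' | h' | h' | h'
      · exact .inr (inRunFromB_of_eq_B h' (.inl rfl))
      · exact .inl ⟨_, by rw [psiWord_mul_add_one, h']; decide, hasPalindromicSuffix_bab (.inl h')⟩
      · exact .inl ⟨_, by rw [psiWord_mul_add_one, h']; decide, hasPalindromicSuffix_bab (.inr h')⟩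
      · have := hasPalindromicSuffix_self (3 * m + 1)
        rw [psiWord_mul_add_one] at this
        exact .inl ⟨_, by rwa [psiWord_mul_add_one], this⟩
      · exact .inl ⟨_, by rwa [psiWord_mul_add_one], h.psi_one⟩
    · exact .inr (h.psi (by norm_num))
    · rcases suffixCandidates_psi_two _ t ht with h' | h'
      · exact .inr (inRunFromB_of_eq_B h' (.inr rfl))
      · exact .inl ⟨_, by rwa [psiWord_mul_add_two], h.psi_two⟩
    · exact .inr (h.psi (by norm_num))

/-! ### The upper bound -/

theorem IsPalindromicFactor.sierpinskiPPL_le {k n : ℕ} (h : IsPalindromicFactor sierpinskiB k n)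
    (hkn : k ≤ n) : sierpinskiPPL n ≤ sierpinskiPPL k + 1 := by
  have := (isPalindromicFactor_sierpinskiWord_iff.2 h).prefixPalindromicLength_le hkn
  rw [sierpinskiPPL, sierpinskiPPL]
  omega

theorem sierpinskiPPL_zero : sierpinskiPPL 0 = 0 := by
  rw [sierpinskiPPL, prefixPalindromicLength_zero]; rfl

theorem exists_sierpinskiPPL_le {n : ℕ} (hn : 0 < n) :
    ∃ k < n, IsPalindromicFactor sierpinskiB k n ∧ sierpinskiPPL k + 1 ≤ sierpinskiPPL n := by
  obtain ⟨k, hk, hpal, hle⟩ := exists_isPalindromicFactor sierpinskiWord hn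
  refine ⟨k, hk, isPalindromicFactor_sierpinskiWord_iff.1 hpal, ?_⟩
  rw [sierpinskiPPL, sierpinskiPPL]
  omega

theorem sierpinskiPPL_mul_three_le (n : ℕ) : sierpinskiPPL (3 * n) ≤ sierpinskiPPL n := by
  induction n using Nat.strong_induction_on with
  | _ n ih =>
    rcases Nat.eq_zero_or_pos n with rfl | hn
    · exact le_rfl
    obtain ⟨k, hk, hpal, hle⟩ := exists_sierpinskiPPL_le hn
    have h1 := hpal.mul_three.sierpinskiPPL_le (by omega)
    have h2 := ih k hk
    omega

/-- Strip both end letters of the last palindrome of an optimal factorization: the right one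
disappears and the left one becomes a palindrome of its own. -/
theorem sierpinskiPPL_le_succ_add_one (n : ℕ) : sierpinskiPPL n ≤ sierpinskiPPL (n + 1) + 1 := by
  obtain ⟨k, hk, hpal, hle⟩ := exists_sierpinskiPPL_le (Nat.add_one_pos n)
  rcases (Nat.le_of_lt_succ hk).eq_or_lt with rfl | hk
  · omega
  · have h1 := hpal.shrink.sierpinskiPPL_le hk
    have h2 := (isPalindromicFactor_succ sierpinskiB k).sierpinskiPPL_le (Nat.le_add_right k 1)
    omega

/-- Only the sum 1 gives the upper bound. The candidates of B̄ serve to produce the candidate (S, 1)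
for the letters S of ψ(B̄). -/
theorem suffixCandidates_snd : ∀ y, ∀ t ∈ suffixCandidates y, t.2 = 1 ∨ y = .Bbar := by decide

theorem psiLetter_eq_Bbar : ∀ y, psiLetter y 0 ≠ .Bbar ∧
    (psiLetter y 1 = .Bbar → weight (psiLetter y 2) = -1) := by decide

theorem sierpinskiPPL_le_psiSum (n : ℕ) : sierpinskiPPL n ≤ psiSum n := by
  induction n using Nat.strong_induction_on with
  | _ n ih =>
    rcases Nat.eq_zero_or_pos n with rfl | hn
    · rw [sierpinskiPPL_zero, psiSum_zero]
    obtain ⟨n, rfl⟩ : ∃ m, n = m + 1 := ⟨n - 1, by omega⟩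
    rcases exists_suffixCandidate n with ⟨t, ht, k, hk, hpal, -, hs⟩ | ⟨-, k, hk, hb, hs⟩
    · rcases suffixCandidates_snd _ t ht with h1 | hB
      · have h2 := hpal.sierpinskiPPL_le (by omega)
        have h3 := ih k (by omega)
        omega
      -- The letter B̄ is never first in a block. If it is second, the third letter has code -1, so
      -- a step back from 3(m+1) costs exactly the allowed 1; if it is third, the prefix length is
      -- 3(m+1).
      · obtain ⟨m, rfl | rfl | rfl⟩ : ∃ m, n = 3 * m ∨ n = 3 * m + 1 ∨ n = 3 * m + 2 :=
          ⟨n / 3, by omega⟩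
        · rw [psiWord_mul] at hB
          exact absurd hB (psiLetter_eq_Bbar _).1
        · rw [psiWord_mul_add_one] at hB
          have h1 := (psiLetter_eq_Bbar _).2 hB
          have h2 := psiSum_mul_add_two' m
          have h3 := sierpinskiPPL_le_succ_add_one (3 * m + 2)
          have h4 := sierpinskiPPL_mul_three_le (m + 1)
          have h5 := ih (m + 1) (by omega)
          rw [show 3 * m + 1 + 1 = 3 * m + 2 by ring]
          rw [show 3 * (m + 1) = 3 * m + 2 + 1 by ring] at h4
          omega
        · have h1 := sierpinskiPPL_mul_three_le (m + 1)
          have h2 := ih (m + 1) (by omega)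
          rw [show 3 * m + 2 + 1 = 3 * (m + 1) by ring, psiSum_mul]
          omega
    · have h1 := (isPalindromicFactor_of_forall fun i hi hi' =>
        hb i hi (Nat.le_of_lt_succ hi')).sierpinskiPPL_le (k := k) (n := n + 1) (by omega)
      have h2 := ih k (by omega)
      omega

theorem sierpinskiPPL_eq_psiSum (n : ℕ) : sierpinskiPPL n = psiSum n :=
  le_antisymm (sierpinskiPPL_le_psiSum n) (psiSum_le_sierpinskiPPL n)

theorem firstDiff_sierpinskiPPL (n : ℕ) : firstDiff sierpinskiPPL n = weight (psiWord n) := by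
  rw [firstDiff, sierpinskiPPL_eq_psiSum, sierpinskiPPL_eq_psiSum, psiSum_succ,
    add_sub_cancel_left]

/-! ### Automaticity and regularity -/

/-- The states are the letters: reading the digit r moves from index n to index 3n + r. The empty
representation of 0 matches the start state A. -/
theorem foldl_baseRepresentation (n : ℕ) :
    (baseRepresentation 3 n).foldl (fun y (r : Fin 3) => psiLetter y r) .A = psiWord n := by
  induction n using Nat.strong_induction_on with
  | _ n ih =>
    rcases Nat.eq_zero_or_pos n with rfl | hn
    · rfl
    have h := ih (n / 3) (by omega)
    rw [baseRepresentation] at h ⊢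
    rw [Nat.digits_def' (by norm_num) hn, List.map_cons, List.reverse_cons, List.foldl_append, h]
    have hr : n % 3 < 3 := Nat.mod_lt n (by norm_num)
    conv_rhs => rw [← Nat.div_add_mod n 3, psiWord_mul_add _ hr]
    simp [Fin.ofNat]

theorem isAutomaticSequence_firstDiff : IsAutomaticSequence 3 (firstDiff sierpinskiPPL) :=
  ⟨DiffLetter, inferInstance, fun y r => psiLetter y r, .A, weight, fun n => by
    rw [firstDiff_sierpinskiPPL, foldl_baseRepresentation]⟩

/-- Every kernel sequence thus differs from `psiSum` by a function of the current letter, so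
`psiSum` and the ten letter indicators span a module containing the kernel. -/
theorem exists_psiSum_pow_mul_add (e : ℕ) : ∀ j < 3 ^ e, ∃ (h : DiffLetter → ℤ)
    (g : DiffLetter → DiffLetter), ∀ n, psiSum (3 ^ e * n + j) = psiSum n + h (psiWord n) ∧
      psiWord (3 ^ e * n + j) = g (psiWord n) := by
  induction e with
  | zero => exact fun j hj => ⟨0, id, fun n => by simp [show j = 0 by simpa using hj]⟩
  | succ e ih =>
    intro j hj
    rw [pow_succ] at hj
    obtain ⟨h, g, hg⟩ := ih (j / 3) (by omega)
    have hsplit : ∀ n, 3 ^ (e + 1) * n + j = 3 * (3 ^ e * n + j / 3) + j % 3 := fun n => by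
      have := Nat.div_add_mod j 3
      rw [pow_succ']
      linarith
    have hr : j % 3 < 3 := Nat.mod_lt j (by norm_num)
    refine ⟨fun y => h y + ∑ i ∈ Finset.range (j % 3), weight (psiLetter (g y) i),
      fun y => psiLetter (g y) (j % 3), fun n => ?_⟩
    obtain ⟨h1, h2⟩ := hg n
    refine ⟨?_, by rw [hsplit, psiWord_mul_add _ hr, h2]⟩
    rw [hsplit]
    interval_cases j % 3
    · simp [psiSum_mul, h1]
    · rw [psiSum_mul_add_one, h1, h2]
      simp [add_assoc]
    · rw [psiSum_mul_add_two, h1, h2]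
      simp [Finset.sum_range_succ, add_assoc]

theorem isRegularSequence_sierpinskiPPL : IsRegularSequence 3 sierpinskiPPL := by
  let ind : DiffLetter → ℕ → ℤ := fun y n => if psiWord n = y then 1 else 0
  let s : Set (ℕ → ℤ) := insert psiSum (Set.range ind)
  have hs : s.Finite := (Set.finite_range ind).insert _
  have := isNoetherian_span_of_finite ℤ hs
  refine Submodule.FG.of_le_of_isNoetherian (T := Submodule.span ℤ s) (Submodule.span_le.2 ?_)
  rintro _ ⟨e, j, hj, rfl⟩
  obtain ⟨h, _, hg⟩ := exists_psiSum_pow_mul_add e j hj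
  have heq : (fun n => sierpinskiPPL (3 ^ e * n + j)) = psiSum + ∑ y, h y • ind y := by
    funext n
    rw [sierpinskiPPL_eq_psiSum, (hg n).1]
    simp [ind]
  rw [heq]
  exact add_mem (Submodule.subset_span (Set.mem_insert _ _)) (Submodule.sum_mem _ fun y _ =>
    Submodule.smul_mem _ _ (Submodule.subset_span (Set.mem_insert_of_mem _ ⟨y, rfl⟩)))

theorem theorem5 :
    IsUniformMorphism 3 psi ∧
    (∀ n : ℕ, firstDiff sierpinskiPPL n = ((coding (morphicWord psi DiffLetter.A n) : SignType) : ℤ)) ∧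
    IsAutomaticSequence 3 (firstDiff sierpinskiPPL) ∧
    IsRegularSequence 3 sierpinskiPPL :=
  ⟨psi_uniform, fun n => (firstDiff_sierpinskiPPL n).trans (coding_eq_weight _).symm,
    isAutomaticSequence_firstDiff, isRegularSequence_sierpinskiPPL⟩
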